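/- Define the Cayley--Dickson algebras by $A_0=\mathbb{R}$ and $A_n=A_{n-1}\times A_{n-1}$ for $n\ge 1$, with componentwise real vector space structure, conjugation $(a,b)^*=(a^*,-b)$ (the identity on $A_0$) and multiplication $(a,b)(c,d)=(ac-d^*b,\;da+bc^*)$. Let $\|a\|=\sqrt{\operatorname{Re}(aa^*)}$, where $\operatorname{Re}(x)=\tfrac12(x+x^*)$ is regarded as a real number. For $0\neq a\in A_n$ let $M_a=\frac{1}{\|a\|^2}L_{a^*}L_a$, an $\mathbb{R}$-linear endomorphism of $A_n$, where $L_b(x)=bx$, and let $\operatorname{Eig}_\lambda(a)$ be the $\lambda$-eigenspace of $M_a$. The multiplicity of $\lambda$ is $\dim_{\mathbb{R}}\operatorname{Eig}_\lambda(a)$. Call a non-zero $a\in A_n$ a top-dimensional zero-divisor if $\dim_{\mathbb R}\operatorname{Eig}_0(a)=2^n-4n+4$. (For $n\ge4$ such an $a$ is indeed a zero-divisor, since this dimension is positive. For $n=3$ the condition says that $\operatorname{Eig}_0(a)=0$.) **Theorem.** Let $n\ge 3$ and let $a\in A_n$ be a top-dimensional zero-divisor. Then the eigenvalues of $M_a$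 are exactly the numbers $2^k$ with $0\le k\le n-3$, together with $0$ when $n\ge 4$. Moreover, the multiplicity of $0$ is $2^n-4n+4$ (which is $0$ when $n=3$), the multiplicity of $1$ is $8$, and every other eigenvalue has multiplicity $4$. -/

import Mathlib

namespace CayleyDickson

/-- The underlying set of the Cayley-Dickson algebra `A_n`:
`A_0 = ℝ` and `A_{n+1} = A_n × A_n`. -/
def A : ℕ → Type
  | 0 => ℝ
  | n + 1 => A n × A n

/-- The additive structure is componentwise. -/
@[reducible] noncomputable def addCommGroupA : (n : ℕ) → AddCommGroup (A n)
  | 0 => inferInstanceAs (AddCommGroup ℝ)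
  | n + 1 =>
    letI := addCommGroupA n
    inferInstanceAs (AddCommGroup (A n × A n))

noncomputable instance (n : ℕ) : AddCommGroup (A n) := addCommGroupA n

/-- The real scalar multiplication is componentwise. -/
@[reducible] noncomputable def moduleA : (n : ℕ) → Module ℝ (A n)
  | 0 => inferInstanceAs (Module ℝ ℝ)
  | n + 1 =>
    letI := moduleA n
    inferInstanceAs (Module ℝ (A n × A n))

noncomputable instance (n : ℕ) : Module ℝ (A n) := moduleA n

/-- The pair `(a, b)` of elements of `A_n`, as an element of `A_{n+1}`. -/
def pair {n : ℕ} (a b : A n) : A (n + 1) := (a, b)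

/-- The first component of an element of `A_{n+1}`. -/
def left {n : ℕ} (x : A (n + 1)) : A n := Prod.fst (α := A n) (β := A n) x

/-- The second component of an element of `A_{n+1}`. -/
def right {n : ℕ} (x : A (n + 1)) : A n := Prod.snd (α := A n) (β := A n) x

/-- Conjugation: the identity on `A_0 = ℝ`, and `(a, b)^* = (a^*, -b)` on `A_{n+1}`. -/
noncomputable def conj : {n : ℕ} → A n → A n
  | 0, x => x
  | _ + 1, x => pair (conj (left x)) (-right x)

/-- Multiplication: the usual one on `A_0 = ℝ`, and
`(a, b)(c, d) = (ac - d^* b, da + b c^*)` on `A_{n+1}`. -/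
noncomputable def mul : {n : ℕ} → A n → A n → A n
  | 0, x, y => (show ℝ from x) * (show ℝ from y)
  | _ + 1, x, y =>
    pair (mul (left x) (left y) - mul (conj (right y)) (right x))
      (mul (right y) (left x) + mul (right x) (conj (left y)))

/-- The unit element: `1 ∈ ℝ = A_0`, and `(1, 0) ∈ A_{n+1}`. -/
noncomputable def one : (n : ℕ) → A n
  | 0 => (1 : ℝ)
  | n + 1 => pair (one n) 0

/-- The real part, as a real number; `half_smul_add_conj` below identifies it
with `(x + x^*) / 2`. -/
def re : {n : ℕ} → A n → ℝ
  | 0, x => x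
  | _ + 1, x => re (left x)

section Basic

variable {n : ℕ}

theorem ext_pair {x y : A (n + 1)} (h1 : left x = left y) (h2 : right x = right y) : x = y :=
  Prod.ext (α := A n) (β := A n) h1 h2

theorem left_pair (a b : A n) : left (pair a b) = a := rfl
theorem right_pair (a b : A n) : right (pair a b) = b := rfl
theorem left_zero : left (0 : A (n + 1)) = 0 := rfl
theorem right_zero : right (0 : A (n + 1)) = 0 := rfl
theorem left_add (x y : A (n + 1)) : left (x + y) = left x + left y := rfl
theorem right_add (x y : A (n + 1)) : right (x + y) = right x + right y := rfl
theorem left_smul (r : ℝ) (x : A (n + 1)) : left (r • x) = r • left x := rfl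
theorem right_smul (r : ℝ) (x : A (n + 1)) : right (r • x) = r • right x := rfl

theorem conj_succ (x : A (n + 1)) : conj x = pair (conj (left x)) (-right x) := rfl

theorem mul_succ (x y : A (n + 1)) :
    mul x y = pair (mul (left x) (left y) - mul (conj (right y)) (right x))
      (mul (right y) (left x) + mul (right x) (conj (left y))) := rfl

theorem conj_add {n : ℕ} (x y : A n) : conj (x + y) = conj x + conj y := by
  induction n with
  | zero => rfl
  | succ n ih =>
    apply ext_pair <;>
      simp only [conj_succ, left_pair, right_pair, left_add, right_add, ih] <;> abel

theorem conj_smul {n : ℕ} (r : ℝ) (x : A n) : conj (r • x) = r • conj x := by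
  induction n with
  | zero => rfl
  | succ n ih =>
    apply ext_pair <;>
      simp only [conj_succ, left_pair, right_pair, left_smul, right_smul, ih, smul_neg]

theorem add_mul' {n : ℕ} (x y z : A n) : mul (x + y) z = mul x z + mul y z ∧
    mul z (x + y) = mul z x + mul z y := by
  induction n with
  | zero => exact ⟨_root_.add_mul (R := ℝ) x y z, _root_.mul_add (R := ℝ) z x y⟩
  | succ n ih =>
    have h1 : ∀ a b c : A n, mul (a + b) c = mul a c + mul b c := fun a b c => (ih a b c).1
    have h2 : ∀ a b c : A n, mul c (a + b) = mul c a + mul c b := fun a b c => (ih a b c).2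
    constructor <;> apply ext_pair <;>
      simp only [mul_succ, left_pair, right_pair, left_add, right_add, conj_add, h1, h2] <;> abel

theorem smul_mul' {n : ℕ} (r : ℝ) (x y : A n) : mul (r • x) y = r • mul x y ∧
    mul x (r • y) = r • mul x y := by
  induction n with
  | zero => exact ⟨smul_mul_assoc (α := ℝ) (β := ℝ) r x y, mul_smul_comm (α := ℝ) (β := ℝ) r x y⟩
  | succ n ih =>
    have h1 : ∀ a b : A n, mul (r • a) b = r • mul a b := fun a b => (ih a b).1
    have h2 : ∀ a b : A n, mul a (r • b) = r • mul a b := fun a b => (ih a b).2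
    constructor <;> apply ext_pair <;>
      simp only [mul_succ, left_pair, right_pair, left_smul, right_smul, conj_smul, h1, h2,
        smul_sub, smul_add]

/-- The real part of `x`, as an element of `A_n`, is `(x + x^*) / 2`. -/
theorem half_smul_add_conj {n : ℕ} (x : A n) : (1 / 2 : ℝ) • (x + conj x) = re x • one n := by
  induction n with
  | zero =>
    have h : ∀ t : ℝ, (1 / 2 : ℝ) • (t + t) = t • (1 : ℝ) := fun t => by
      simp only [smul_eq_mul]; ring
    exact h x
  | succ n ih =>
    apply ext_pair
    · exact ih (left x)
    · simp only [right_smul, right_add, conj_succ, right_pair, one, add_neg_cancel, smul_zero]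

end Basic

/-- The real inner product `⟨a, b⟩_ℝ = Re (a b^*)`. -/
noncomputable def innerR {n : ℕ} (a b : A n) : ℝ := re (mul a (conj b))

/-- The norm `‖a‖ = √⟨a, a⟩_ℝ`. -/
noncomputable def norm {n : ℕ} (a : A n) : ℝ := Real.sqrt (innerR a a)

/-- Left multiplication `L_a`, as a real linear map. -/
noncomputable def L {n : ℕ} (a : A n) : A n →ₗ[ℝ] A n where
  toFun x := mul a x
  map_add' x y := (add_mul' x y a).2
  map_smul' r x := (smul_mul' r a x).2

/-- The real linear map `M_a = ‖a‖⁻² L_{a^*} L_a` (for `a ≠ 0`). -/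
noncomputable def M {n : ℕ} (a : A n) : A n →ₗ[ℝ] A n :=
  (1 / norm a ^ 2) • (L (conj a) ∘ₗ L a)

/-- The `lam`-eigenspace of `a`, that is, of `M_a`. -/
noncomputable def Eig {n : ℕ} (lam : ℝ) (a : A n) : Submodule ℝ (A n) :=
  Module.End.eigenspace (M a) lam

/-- Top-dimensional zero-divisors of `A_n`: nonzero elements whose `0`-eigenspace has dimension
`2^n - 4n + 4`. For `n ≥ 4` this dimension is positive, so that such an element is a zero-divisor;
for `n = 3` the dimension is `0`. -/
def IsTopDimZeroDivisor {n : ℕ} (a : A n) : Prop :=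
  a ≠ 0 ∧ (Module.finrank ℝ (Eig 0 a) : ℤ) = 2 ^ n - 4 * n + 4

end CayleyDickson

/-!
Left multiplication by `a^*` is adjoint to left multiplication by `a`, so `M a` is symmetric and
`Eig 0 a` is the annihilator of `a`; every eigenspace other than `Eig 1 a` is orthogonal to
`ℂ = span {1, i_n}`. For `p` orthogonal to `ℂ` and `ε = ±1`, the elements `{p}_ε = (p, ε i_n p)`
with the same sign multiply like elements of the smaller algebra up to a factor `2`, while elements
with opposite signs have product in `ℂ ⊕ ℂ`. Hence passing from `p` to `{p}_ε` doubles the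
eigenvalues on the orthogonal complement of the quaternions `span {1, i_n, p, i_n p}`, makes the
multiplicity of `1` at least `8`, and adds at most `2 ^ (n + 1) - 4` dimensions to the annihilator
when `p ∈ A (n + 1)`. Comparing an arbitrary `a = {p}_1 + {q}_{-1}` with `p` and `q` shows that only
elements `{p}_ε` with `p` itself top-dimensional can attain the maximal dimension of the
annihilator. By induction, starting from an analysis of the associator of the octonions for `A 4`,
this gives lower bounds for the multiplicities; as these already sum to `2 ^ n`, they are equalities
and there are no other eigenvalues.
-/

namespace CayleyDickson

open Module Submodule
open scoped RealInnerProductSpace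

section LinearAlgebra

theorem finrank_le_finrank_of_injOn {R V W : Type*} [Semiring R] [StrongRankCondition R]
    [AddCommMonoid V] [Module R V] [AddCommMonoid W] [Module R W] {S : Submodule R V}
    {T : Submodule R W} [Module.Finite R T] {f : V →ₗ[R] W} (h : ∀ x ∈ S, f x ∈ T)
    (hf : Set.InjOn f S) : finrank R S ≤ finrank R T :=
  LinearMap.finrank_le_finrank_of_injective (f := f.restrict h) fun x y hxy =>
    Subtype.ext (hf x.2 y.2 (congrArg Subtype.val hxy))

theorem sum_finrank_le_of_iSupIndep {K V ι : Type*} [DivisionRing K] [AddCommGroup V] [Module K V]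
    [FiniteDimensional K V] {p : ι → Submodule K V} (hp : iSupIndep p) (s : Finset ι) :
    ∑ i ∈ s, finrank K (p i) ≤ finrank K V := by
  classical
  have h := LinearMap.finrank_le_finrank_of_injective
    (hp.comp (f := Subtype.val (p := (· ∈ s))) Subtype.val_injective).dfinsupp_lsum_injective
  rwa [← Finset.sum_coe_sort, ← finrank_directSum]

theorem finrank_eigenspace_eq_of_finrank_le_sum {K V : Type*} [Field K] [AddCommGroup V]
    [Module K V] [FiniteDimensional K V] {f : End K V} {s : Finset K} {d : K → ℕ}
    (hd : ∀ r ∈ s, d r ≤ finrank K (f.eigenspace r)) (hs : finrank K V ≤ ∑ r ∈ s, d r) :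
    (∀ r ∈ s, finrank K (f.eigenspace r) = d r) ∧ ∀ r, f.HasEigenvalue r → r ∈ s := by
  classical
  have hle := Finset.sum_le_sum hd
  refine ⟨fun r hr => ?_, fun r hr => ?_⟩
  · have hsum := sum_finrank_le_of_iSupIndep f.eigenspaces_iSupIndep s
    exact ((Finset.sum_eq_sum_iff_of_le hd).1 (by omega) r hr).symm
  · by_contra hrs
    have hsum := sum_finrank_le_of_iSupIndep f.eigenspaces_iSupIndep (insert r s)
    rw [Finset.sum_insert hrs] at hsum
    have hr0 : finrank K (f.eigenspace r) = 0 := by omega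
    exact hr (finrank_eq_zero.1 hr0)

variable {𝕜 E ι : Type*} [RCLike 𝕜] [NormedAddCommGroup E] [InnerProductSpace 𝕜 E]

theorem mem_orthogonal_span_range {v : ι → E} {x : E} :
    x ∈ (span 𝕜 (Set.range v))ᗮ ↔ ∀ i, inner 𝕜 (v i) x = 0 := by
  rw [← span_singleton_le_iff_mem, ← isOrtho_iff_le, isOrtho_comm, isOrtho_span]
  simp only [Set.mem_range, Set.mem_singleton_iff, forall_exists_index, forall_apply_eq_imp_iff,
    forall_eq]

theorem finrank_le_finrank_inf_orthogonal_add [FiniteDimensional 𝕜 E] (S T : Submodule 𝕜 E) :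
    finrank 𝕜 S ≤ finrank 𝕜 (S ⊓ Tᗮ : Submodule 𝕜 E) + finrank 𝕜 T := by
  have hsup := finrank_sup_add_finrank_inf_eq S Tᗮ
  have hT := T.finrank_add_finrank_orthogonal
  have hle := (S ⊔ Tᗮ).finrank_le
  omega

end LinearAlgebra

variable {n : ℕ}

section Algebra

attribute [simp] left_pair right_pair left_zero right_zero left_add right_add left_smul right_smul

@[simp] theorem left_neg (x : A (n + 1)) : left (-x) = -left x := rfl
@[simp] theorem right_neg (x : A (n + 1)) : right (-x) = -right x := rfl
@[simp] theorem left_sub (x y : A (n + 1)) : left (x - y) = left x - left y := rfl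
@[simp] theorem right_sub (x y : A (n + 1)) : right (x - y) = right x - right y := rfl

noncomputable instance : NonUnitalNonAssocRing (A n) where
  mul := mul
  left_distrib x y z := (add_mul' y z x).2
  right_distrib x y z := (add_mul' x y z).1
  zero_mul x := by change mul 0 x = 0; simpa only [zero_smul] using (smul_mul' 0 x x).1
  mul_zero x := by change mul x 0 = 0; simpa only [zero_smul] using (smul_mul' 0 x x).2

instance : IsScalarTower ℝ (A n) (A n) where
  smul_assoc r x y := (smul_mul' r x y).1

instance : SMulCommClass ℝ (A n) (A n) where
  smul_comm r x y := (smul_mul' r x y).2.symm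

noncomputable instance : Star (A n) where
  star := conj

noncomputable instance : One (A n) where
  one := one n

@[simp] theorem left_mul (x y : A (n + 1)) :
    left (x * y) = left x * left y - star (right y) * right x := rfl
@[simp] theorem right_mul (x y : A (n + 1)) :
    right (x * y) = right y * left x + right x * star (left y) := rfl
@[simp] theorem left_star (x : A (n + 1)) : left (star x) = star (left x) := rfl
@[simp] theorem right_star (x : A (n + 1)) : right (star x) = -right x := rfl
@[simp] theorem left_one : left (1 : A (n + 1)) = 1 := rfl
@[simp] theorem right_one : right (1 : A (n + 1)) = 0 := rfl

noncomputable instance : StarAddMonoid (A n) where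
  star_involutive x := by
    induction n with
    | zero => rfl
    | succ n ih => exact ext_pair (by simp [ih (left x)]) (by simp)
  star_add := conj_add

instance : StarModule ℝ (A n) where
  star_smul := conj_smul

noncomputable instance : StarRing (A n) where
  star_add := conj_add
  star_mul x y := by
    induction n with
    | zero => exact _root_.mul_comm (G := ℝ) x y
    | succ n ih => exact ext_pair (by simp [ih]) (by simp [add_comm])

theorem one_mul_and_mul_one (x : A n) : 1 * x = x ∧ x * 1 = x := by
  have star_one : ∀ m, star (1 : A m) = 1 := by
    intro m
    induction m with
    | zero => rfl
    | succ m ih => exact ext_pair (by simp [ih]) (by simp)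
  induction n with
  | zero => exact ⟨_root_.one_mul (M := ℝ) x, _root_.mul_one (M := ℝ) x⟩
  | succ n ih =>
    exact ⟨ext_pair (by simp [ih]) (by simp [ih]),
      ext_pair (by simp [ih]) (by simp [ih, star_one])⟩

noncomputable instance : NonAssocRing (A n) where
  one_mul x := (one_mul_and_mul_one x).1
  mul_one x := (one_mul_and_mul_one x).2

@[simp] theorem L_apply (a x : A n) : L a x = a * x := rfl

end Algebra

section RealPart

theorem re_add (x y : A n) : re (x + y) = re x + re y := by
  induction n with
  | zero => rfl
  | succ n ih => exact ih _ _

theorem re_smul (r : ℝ) (x : A n) : re (r • x) = r * re x := by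
  induction n with
  | zero => rfl
  | succ n ih => exact ih _

theorem re_sub (x y : A n) : re (x - y) = re x - re y := by
  rw [sub_eq_add_neg, ← neg_one_smul ℝ y, re_add, re_smul]; ring

@[simp] theorem re_neg (x : A n) : re (-x) = -re x := by
  rw [← neg_one_smul ℝ x, re_smul, neg_one_mul]

@[simp] theorem re_zero : re (0 : A n) = 0 := by
  simpa using re_smul (0 : ℝ) (0 : A n)

@[simp] theorem re_one : re (1 : A n) = 1 := by
  induction n with
  | zero => rfl
  | succ _ ih => exact ih

@[simp] theorem re_star (x : A n) : re (star x) = re x := by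
  induction n with
  | zero => rfl
  | succ n ih => exact ih _

@[simp] theorem re_left (x : A (n + 1)) : re (left x) = re x := rfl

@[simp] theorem re_pair (x y : A n) : re (pair x y) = re x := rfl

instance : Nontrivial (A n) :=
  nontrivial_of_ne 1 0 fun h => one_ne_zero (α := ℝ) <| by rw [← re_one, h, re_zero]

theorem add_star_self (x : A n) : x + star x = (2 * re x) • (1 : A n) := by
  have h : (1 / 2 : ℝ) • (x + star x) = re x • (1 : A n) := half_smul_add_conj x
  rw [mul_smul, ← h, smul_smul]
  norm_num

theorem star_eq_sub (x : A n) : star x = (2 * re x) • 1 - x := by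
  rw [← add_star_self]; abel

theorem star_eq_neg_of_re_eq_zero {x : A n} (hx : re x = 0) : star x = -x := by
  have := add_star_self x
  rw [hx, mul_zero, zero_smul] at this
  exact (neg_eq_of_add_eq_zero_right this).symm

theorem re_mul_comm (x y : A n) : re (x * y) = re (y * x) := by
  induction n with
  | zero => exact mul_comm (G := ℝ) x y
  | succ n ih =>
    have h : re (star (right y) * right x) = re (star (right x) * right y) := by
      rw [← re_star, star_mul, star_star]
    rw [← re_left, ← re_left (y * x), left_mul, left_mul, re_sub, re_sub, ih (left x), h]

theorem re_mul_assoc (x y z : A n) : re (x * y * z) = re (x * (y * z)) := by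
  induction n with
  | zero => exact mul_assoc (G := ℝ) x y z
  | succ n ih =>
    have cyclic (a b c : A n) : re (a * (b * c)) = re (b * (c * a)) := by rw [re_mul_comm, ih]
    rw [← re_left, ← re_left (x * (y * z))]
    simp only [left_mul, right_mul, sub_mul, mul_sub, add_mul, mul_add, star_add, star_mul,
      star_star, re_sub, re_add, ih]
    rw [cyclic (left x) (star (right z)), cyclic (star (left y)), cyclic (left z)]
    ring

end RealPart

section Inner

theorem innerR_eq_re (x y : A n) : innerR x y = re (x * star y) := rfl

theorem innerR_succ (x y : A (n + 1)) :
    innerR x y = innerR (left x) (left y) + innerR (right x) (right y) := by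
  rw [innerR_eq_re, innerR_eq_re, innerR_eq_re, ← re_left, left_mul, left_star, right_star,
    star_neg, neg_mul, sub_neg_eq_add, re_add, re_mul_comm (star _)]

theorem innerR_self_nonneg (x : A n) : 0 ≤ innerR x x := by
  induction n with
  | zero => exact mul_self_nonneg (R := ℝ) x
  | succ n ih => rw [innerR_succ]; exact add_nonneg (ih _) (ih _)

theorem eq_zero_of_innerR_self_eq_zero {x : A n} (h : innerR x x = 0) : x = 0 := by
  induction n with
  | zero => exact mul_self_eq_zero (M₀ := ℝ).1 h
  | succ n ih =>
    rw [innerR_succ, add_eq_zero_iff_of_nonneg (innerR_self_nonneg _) (innerR_self_nonneg _)] at h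
    exact ext_pair (ih h.1) (ih h.2)

/-- The inner product `⟨x, y⟩ = Re (x y^*)`, making `A n` a Euclidean space. -/
@[reducible] noncomputable def innerProductCore (n : ℕ) : InnerProductSpace.Core ℝ (A n) where
  inner := innerR
  conj_inner_symm x y := by
    change re (y * star x) = re (x * star y)
    rw [← re_star, star_mul, star_star]
  re_inner_nonneg := innerR_self_nonneg
  add_left x y z := by
    change re _ = re _ + re _
    rw [← re_add]
    exact congrArg re (add_mul x y _)
  smul_left x y r := by
    change re _ = r * re _
    rw [← re_smul]
    exact congrArg re (smul_mul_assoc r x _)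
  definite _ := eq_zero_of_innerR_self_eq_zero

noncomputable instance : NormedAddCommGroup (A n) :=
  (innerProductCore n).toNormedAddCommGroup

noncomputable instance : InnerProductSpace ℝ (A n) :=
  InnerProductSpace.ofCore (innerProductCore n).toCore

theorem inner_eq_re (x y : A n) : ⟪x, y⟫ = re (x * star y) := rfl

theorem inner_succ (x y : A (n + 1)) : ⟪x, y⟫ = ⟪left x, left y⟫ + ⟪right x, right y⟫ :=
  innerR_succ x y

theorem inner_pair_left (x y : A n) (w : A (n + 1)) :
    ⟪pair x y, w⟫ = ⟪x, left w⟫ + ⟪y, right w⟫ := inner_succ _ _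

theorem norm_sq_succ (x : A (n + 1)) : ‖x‖ ^ 2 = ‖left x‖ ^ 2 + ‖right x‖ ^ 2 := by
  simp only [← real_inner_self_eq_norm_sq, inner_succ]

theorem inner_one_right (x : A n) : ⟪x, 1⟫ = re x := by
  rw [inner_eq_re, star_one, mul_one]

theorem inner_mul_left (a x y : A n) : ⟪a * x, y⟫ = ⟪x, star a * y⟫ := by
  rw [inner_eq_re, inner_eq_re, re_mul_assoc, re_mul_comm, re_mul_assoc, star_mul, star_star]

theorem norm_star_sq (x : A n) : ‖star x‖ ^ 2 = ‖x‖ ^ 2 := by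
  rw [← real_inner_self_eq_norm_sq, ← real_inner_self_eq_norm_sq, inner_eq_re, inner_eq_re,
    star_star, re_mul_comm]

theorem self_mul_star (x : A n) : x * star x = ‖x‖ ^ 2 • (1 : A n) := by
  induction n with
  | zero =>
    rw [← real_inner_self_eq_norm_sq]
    exact (_root_.mul_one (M := ℝ) _).symm
  | succ n ih =>
    have h := ih (star (right x))
    rw [star_star, norm_star_sq] at h
    exact ext_pair (by simp [ih, h, norm_sq_succ, add_smul]) (by simp)

theorem star_mul_self (x : A n) : star x * x = ‖x‖ ^ 2 • (1 : A n) := by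
  rw [← norm_star_sq, ← self_mul_star, star_star]

theorem mul_self_eq (x : A n) : x * x = (2 * re x) • x - ‖x‖ ^ 2 • 1 := by
  rw [← star_mul_self, star_eq_sub, sub_mul, smul_one_mul]; abel

theorem mul_self_of_re_eq_zero {x : A n} (hx : re x = 0) : x * x = -(‖x‖ ^ 2 • (1 : A n)) := by
  rw [← star_mul_self, star_eq_neg_of_re_eq_zero hx, neg_mul, neg_neg]

end Inner

section Dimension

/-- `A (n + 1)` is `A n × A n` as a real vector space. -/
noncomputable def prodEquiv (n : ℕ) : A (n + 1) ≃ₗ[ℝ] A n × A n := LinearEquiv.refl ℝ (A n × A n)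

instance : Module.Finite ℝ (A n) := by
  induction n with
  | zero => exact inferInstanceAs (Module.Finite ℝ ℝ)
  | succ n ih => exact Module.Finite.equiv (prodEquiv n).symm

theorem finrank_A (n : ℕ) : finrank ℝ (A n) = 2 ^ n := by
  induction n with
  | zero => exact finrank_self ℝ
  | succ n ih => rw [(prodEquiv n).finrank_eq, finrank_prod, ih, pow_succ]; ring

/-- The first component, as a linear map. -/
noncomputable def leftLm (n : ℕ) : A (n + 1) →ₗ[ℝ] A n where
  toFun := left
  map_add' := left_add
  map_smul' := left_smul

@[simp] theorem leftLm_apply (x : A (n + 1)) : leftLm n x = left x := rfl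

theorem finrank_add_finrank_le_of_pair_mem {S T : Submodule ℝ (A n)} {U : Submodule ℝ (A (n + 1))}
    (h : ∀ x ∈ S, ∀ y ∈ T, pair x y ∈ U) : finrank ℝ S + finrank ℝ T ≤ finrank ℝ U := by
  rw [← finrank_prod]
  refine LinearMap.finrank_le_finrank_of_injective (f := ((prodEquiv n).symm.toLinearMap ∘ₗ
    S.subtype.prodMap T.subtype).codRestrict U fun z => h z.1 z.1.2 z.2 z.2.2) fun z w hzw => ?_
  have hpair : pair (z.1 : A n) z.2 = pair w.1 w.2 := congrArg Subtype.val hzw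
  exact Prod.ext (Subtype.ext (congrArg left hpair)) (Subtype.ext (congrArg right hpair))

end Dimension

section Eigenspaces

variable {a x : A n} {lam mu : ℝ}

theorem M_apply (a x : A n) : M a x = (1 / ‖a‖ ^ 2) • (star a * (a * x)) := rfl

theorem mem_Eig_iff (ha : a ≠ 0) : x ∈ Eig lam a ↔ star a * (a * x) = (lam * ‖a‖ ^ 2) • x := by
  have ha' : ‖a‖ ^ 2 ≠ 0 := pow_ne_zero 2 (norm_ne_zero_iff.2 ha)
  rw [Eig, Module.End.mem_eigenspace_iff, M_apply, one_div, inv_smul_eq_iff₀ ha', smul_smul,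
    mul_comm]

theorem isSymmetric_M (a : A n) : (M a).IsSymmetric := fun x y => by
  rw [M_apply, M_apply, real_inner_smul_left, real_inner_smul_right, inner_mul_left,
    inner_mul_left, star_star]

theorem Eig_isOrtho (h : lam ≠ mu) : Eig lam a ⟂ Eig mu a :=
  (isSymmetric_M a).orthogonalFamily_eigenspaces.isOrtho h

theorem Eig_le_orthogonal (h : lam ≠ 1) {S : Submodule ℝ (A n)} (hS : S ≤ Eig 1 a) :
    Eig lam a ≤ Sᗮ :=
  (Eig_isOrtho h).mono_right hS

theorem Eig_zero_eq_ker (ha : a ≠ 0) : Eig 0 a = LinearMap.ker (L a) := by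
  ext x
  rw [mem_Eig_iff ha, zero_mul, zero_smul, LinearMap.mem_ker, L_apply]
  refine ⟨fun h => ?_, fun h => by rw [h, mul_zero]⟩
  rw [← inner_self_eq_zero (𝕜 := ℝ), inner_mul_left, h, inner_zero_right]

theorem one_mem_Eig_one (ha : a ≠ 0) : (1 : A n) ∈ Eig 1 a := by
  rw [mem_Eig_iff ha, mul_one, star_mul_self, one_mul]

theorem mul_mem_Eig (ha : star a = -a) (hx : x ∈ Eig lam a) : a * x ∈ Eig lam a := by
  rw [Eig, Module.End.mem_eigenspace_iff, M_apply, ha] at hx ⊢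
  rw [neg_mul] at hx ⊢
  rw [← mul_smul_comm lam, ← hx, mul_smul_comm, mul_neg]

end Eigenspaces

section ImaginaryUnit

/-- The imaginary unit `i_n = (0, 1)`; together with `1` it spans a copy of `ℂ`. -/
noncomputable def I : A (n + 1) := pair 0 1

@[simp] theorem left_I : left (I : A (n + 1)) = 0 := rfl
@[simp] theorem right_I : right (I : A (n + 1)) = 1 := rfl

theorem I_mul (x : A (n + 1)) : I * x = pair (-star (right x)) (star (left x)) :=
  ext_pair (by simp) (by simp)

theorem mul_I (x : A (n + 1)) : x * I = pair (-right x) (left x) :=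
  ext_pair (by simp) (by simp)

theorem star_I : star (I : A (n + 1)) = -I := ext_pair (by simp) (by simp)

theorem I_mul_I_mul (x : A (n + 1)) : I * (I * x) = -x := by
  rw [I_mul, I_mul]
  exact ext_pair (by simp) (by simp)

theorem I_mul_mul_I (x : A (n + 1)) : I * (x * I) = pair (-star (left x)) (-star (right x)) := by
  rw [I_mul, mul_I]
  exact ext_pair (by simp) (by simp)

theorem norm_I_mul_sq (x : A (n + 1)) : ‖I * x‖ ^ 2 = ‖x‖ ^ 2 := by
  rw [← real_inner_self_eq_norm_sq, inner_mul_left, star_I, neg_mul, I_mul_I_mul, neg_neg,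
    real_inner_self_eq_norm_sq]

theorem inner_I_mul_self (x : A (n + 1)) : ⟪x, I * x⟫ = 0 := by
  have h : ⟪I * x, x⟫ = -⟪x, I * x⟫ := by rw [inner_mul_left, star_I, neg_mul, inner_neg_right]
  rw [real_inner_comm] at h
  linarith

theorem inner_I_right (x : A (n + 1)) : ⟪x, I⟫ = re (right x) := by
  rw [inner_succ, left_I, right_I, inner_zero_right, zero_add, inner_one_right]

theorem inner_I_left (x : A (n + 1)) : ⟪I, x⟫ = re (right x) := by
  rw [real_inner_comm, inner_I_right]

theorem I_mem_Eig_one {a : A (n + 1)} (ha : a ≠ 0) : I ∈ Eig 1 a := by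
  rw [mem_Eig_iff ha, one_mul, mul_I]
  refine ext_pair (by simp) ?_
  simp [self_mul_star, norm_sq_succ, add_smul]

/-- The orthogonal complement of the complex line `ℂ = span {1, i_n}`. -/
noncomputable def complexPerp (n : ℕ) : Submodule ℝ (A (n + 1)) := (span ℝ {1, I})ᗮ

variable {p x : A (n + 1)}

theorem mem_complexPerp_iff_inner : x ∈ complexPerp n ↔ ⟪x, 1⟫ = 0 ∧ ⟪x, I⟫ = 0 := by
  rw [complexPerp, span_insert, ← inf_orthogonal, mem_inf,
    mem_orthogonal_singleton_iff_inner_left, mem_orthogonal_singleton_iff_inner_left]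

theorem mem_complexPerp : x ∈ complexPerp n ↔ re x = 0 ∧ re (right x) = 0 := by
  rw [mem_complexPerp_iff_inner, inner_one_right, inner_I_right]

theorem Eig_le_complexPerp {a : A (n + 1)} (ha : a ≠ 0) {lam : ℝ} (h : lam ≠ 1) :
    Eig lam a ≤ complexPerp n :=
  Eig_le_orthogonal h <| span_le.2 <|
    Set.pair_subset (one_mem_Eig_one ha) (I_mem_Eig_one ha)

theorem right_mem_complexPerp_of_mul_eq_zero (hp : p ≠ 0) (h : p * x = 0) : x ∈ complexPerp n :=
  Eig_le_complexPerp hp zero_ne_one <| by rwa [Eig_zero_eq_ker hp]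

theorem star_of_mem_complexPerp (hx : x ∈ complexPerp n) : star x = -x :=
  star_eq_neg_of_re_eq_zero (mem_complexPerp.1 hx).1

theorem I_mul_mem_complexPerp (hx : x ∈ complexPerp n) : I * x ∈ complexPerp n := by
  rw [mem_complexPerp] at *
  simpa [I_mul] using hx.symm

theorem mul_I_of_mem_complexPerp (hx : x ∈ complexPerp n) : x * I = -(I * x) := by
  rw [mem_complexPerp] at hx
  rw [I_mul, mul_I]
  exact ext_pair (by simp [star_eq_neg_of_re_eq_zero, hx])
    (by simp [star_eq_neg_of_re_eq_zero, hx])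

theorem mul_I_mul_of_mem_complexPerp (hp : p ∈ complexPerp n) (hx : x ∈ complexPerp n) :
    p * (I * x) = -(I * (p * x)) := by
  rw [mem_complexPerp] at *
  rw [I_mul, I_mul]
  refine ext_pair ?_ ?_ <;> simp [star_eq_neg_of_re_eq_zero, hp, hx, sub_eq_add_neg, add_comm]

theorem I_mul_mul_of_mem_complexPerp (hp : p ∈ complexPerp n) (hx : x ∈ complexPerp n) :
    (I * p) * x = (p * x) * I := by
  rw [mem_complexPerp] at *
  rw [I_mul, mul_I]
  refine ext_pair ?_ ?_ <;> simp [star_eq_neg_of_re_eq_zero, hp, hx, sub_eq_add_neg, add_comm]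

theorem star_mul_of_mem_complexPerp (hp : p ∈ complexPerp n) (hx : x ∈ complexPerp n) :
    star (p * x) = x * p := by
  rw [star_mul, star_of_mem_complexPerp hp, star_of_mem_complexPerp hx, neg_mul_neg]

theorem mul_mem_complexPerp_iff (hp : p ∈ complexPerp n) :
    p * x ∈ complexPerp n ↔ ⟪p, x⟫ = 0 ∧ ⟪I * p, x⟫ = 0 := by
  rw [mem_complexPerp_iff_inner, inner_mul_left, inner_mul_left, mul_one,
    star_of_mem_complexPerp hp, neg_mul, mul_I_of_mem_complexPerp hp, neg_neg, inner_neg_right,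
    neg_eq_zero, real_inner_comm p x, real_inner_comm (I * p) x]

theorem mul_self_of_mem_complexPerp (hp : p ∈ complexPerp n) :
    p * p = -(‖p‖ ^ 2 • (1 : A (n + 1))) :=
  mul_self_of_re_eq_zero (mem_complexPerp.1 hp).1

theorem mul_I_mul_self_of_mem_complexPerp (hp : p ∈ complexPerp n) :
    p * (I * p) = ‖p‖ ^ 2 • (I : A (n + 1)) := by
  rw [mul_I_mul_of_mem_complexPerp hp hp, mul_self_of_mem_complexPerp hp, mul_neg, neg_neg,
    mul_smul_comm, mul_one]

end ImaginaryUnit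

section Quaternions

variable {p x : A (n + 1)}

/-- The family `1, i_n, p, i_n p`. For `p ≠ 0` orthogonal to `ℂ` it is an orthogonal basis of a
subalgebra isomorphic to the quaternions. -/
noncomputable def quatFamily (p : A (n + 1)) : Fin 4 → A (n + 1) := ![1, I, p, I * p]

/-- The subalgebra generated by `ℂ` and `p` when `p` is orthogonal to `ℂ`, as a subspace. -/
noncomputable def quat (p : A (n + 1)) : Submodule ℝ (A (n + 1)) :=
  span ℝ (Set.range (quatFamily p))

theorem quat_le_iff {S : Submodule ℝ (A (n + 1))} :
    quat p ≤ S ↔ 1 ∈ S ∧ I ∈ S ∧ p ∈ S ∧ I * p ∈ S := by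
  rw [quat, span_le, Set.range_subset_iff]
  simp [quatFamily, Fin.forall_fin_succ]

theorem mem_orthogonal_quat_iff (hp : p ∈ complexPerp n) :
    x ∈ (quat p)ᗮ ↔ x ∈ complexPerp n ∧ p * x ∈ complexPerp n := by
  rw [mul_mem_complexPerp_iff hp, mem_complexPerp_iff_inner, quat, mem_orthogonal_span_range,
    real_inner_comm, real_inner_comm I]
  simp [quatFamily, Fin.forall_fin_succ, and_assoc]

theorem I_mul_mem_orthogonal_quat (hp : p ∈ complexPerp n) (hx : x ∈ (quat p)ᗮ) :
    I * x ∈ (quat p)ᗮ := by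
  rw [mem_orthogonal_quat_iff hp] at *
  rw [mul_I_mul_of_mem_complexPerp hp hx.1, neg_mem_iff]
  exact ⟨I_mul_mem_complexPerp hx.1, I_mul_mem_complexPerp hx.2⟩

theorem finrank_quat (h0 : p ≠ 0) (hp : p ∈ complexPerp n) : finrank ℝ (quat p) = 4 := by
  obtain ⟨hp1, hpI⟩ := mem_complexPerp_iff_inner.1 hp
  obtain ⟨hIp1, hIpI⟩ := mem_complexPerp_iff_inner.1 (I_mul_mem_complexPerp hp)
  have hpIp := inner_I_mul_self p
  have h1I : ⟪I, (1 : A (n + 1))⟫ = 0 := by rw [inner_one_right]; exact re_zero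
  have hortho : Pairwise fun i j => ⟪quatFamily p i, quatFamily p j⟫ = 0 := by
    intro i j hij
    fin_cases i <;> fin_cases j <;> simp_all [quatFamily, real_inner_comm]
  refine finrank_span_eq_card (linearIndependent_of_ne_zero_of_inner_eq_zero ?_ hortho)
  have hI0 : (I : A (n + 1)) ≠ 0 := fun h => one_ne_zero (congrArg right h)
  have hIp0 : I * p ≠ 0 := fun h => h0 <| by simpa [h] using I_mul_I_mul p
  simp [quatFamily, Fin.forall_fin_succ, *]

theorem quat_le_Eig_one (h0 : p ≠ 0) (hp : p ∈ complexPerp n) : quat p ≤ Eig 1 p := by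
  have hstar := star_of_mem_complexPerp hp
  have hI : p * I ∈ Eig 1 p := mul_mem_Eig hstar (I_mem_Eig_one h0)
  rw [mul_I_of_mem_complexPerp hp, neg_mem_iff] at hI
  have h1 : p * 1 ∈ Eig 1 p := mul_mem_Eig hstar (one_mem_Eig_one h0)
  exact quat_le_iff.2 ⟨one_mem_Eig_one h0, I_mem_Eig_one h0, by rwa [mul_one] at h1, hI⟩

end Quaternions

section Bracket

/-- The elements `{p}_ε = (p, ε i_n p)`. For `p` orthogonal to `ℂ` and `ε = ±1` they form two
complementary halves of `(ℂ ⊕ ℂ)ᗮ`. -/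
noncomputable def bracket (ε : ℝ) : A (n + 1) →ₗ[ℝ] A (n + 2) where
  toFun p := pair p (ε • (I * p))
  map_add' p q := ext_pair rfl (by simp [mul_add])
  map_smul' r p := ext_pair rfl (by simp [mul_smul_comm, smul_comm ε])

/-- The linear map taking `{x}_ε + {y}_{-ε}` to `x`, when `ε = ±1`. -/
noncomputable def component (ε : ℝ) : A (n + 2) →ₗ[ℝ] A (n + 1) where
  toFun w := (1 / 2 : ℝ) • (left w - ε • (I * right w))
  map_add' v w := by
    simp only [left_add, right_add, mul_add, smul_add]
    module
  map_smul' r w := by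
    simp only [left_smul, right_smul, mul_smul_comm, RingHom.id_apply]
    module

variable {p x : A (n + 1)} {w : A (n + 2)} {ε : ℝ}

@[simp] theorem left_bracket (ε : ℝ) (p : A (n + 1)) : left (bracket ε p) = p := rfl
@[simp] theorem right_bracket (ε : ℝ) (p : A (n + 1)) : right (bracket ε p) = ε • (I * p) := rfl

theorem component_apply (ε : ℝ) (w : A (n + 2)) :
    component ε w = (1 / 2 : ℝ) • (left w - ε • (I * right w)) := rfl

theorem bracket_injective (ε : ℝ) : Function.Injective (bracket ε : A (n + 1) →ₗ[ℝ] A (n + 2)) :=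
  fun _ _ h => congrArg left h

theorem bracket_eq_zero : bracket ε p = 0 ↔ p = 0 := map_eq_zero_iff _ (bracket_injective ε)

theorem bracket_ne_zero (h0 : p ≠ 0) : bracket ε p ≠ 0 := bracket_eq_zero.not.2 h0

theorem bracket_component_add (hε : ε * ε = 1) (w : A (n + 2)) :
    bracket ε (component ε w) + bracket (-ε) (component (-ε) w) = w := by
  simp only [component_apply, map_smul, map_sub]
  refine ext_pair ?_ ?_
  · simp only [left_add, left_smul, left_sub, left_bracket]
    module
  · simp only [right_add, right_smul, right_sub, right_bracket, I_mul_I_mul]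
    linear_combination (norm := module) hε • right w

theorem component_bracket_add (hε : ε * ε = 1) (x y : A (n + 1)) :
    component ε (bracket ε x + bracket (-ε) y) = x := by
  simp only [component_apply, left_add, right_add, left_bracket, right_bracket, mul_add,
    mul_smul_comm, I_mul_I_mul]
  linear_combination (norm := module) ((1 / 2 : ℝ) * hε) • (x - y)

theorem component_mem {S : Submodule ℝ (A (n + 1))} (hS : ∀ x ∈ S, I * x ∈ S)
    (hl : left w ∈ S) (hr : right w ∈ S) : component ε w ∈ S :=
  S.smul_mem _ (S.sub_mem hl (S.smul_mem _ (hS _ hr)))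

theorem bracket_mem_complexPerp (hp : p ∈ complexPerp n) :
    bracket ε p ∈ complexPerp (n + 1) := by
  rw [mem_complexPerp] at *
  exact ⟨hp.1, by simp [I_mul, re_smul, hp]⟩

theorem inner_bracket_left (ε : ℝ) (p : A (n + 1)) (w : A (n + 2)) :
    ⟪bracket ε p, w⟫ = 2 * ⟪p, component ε w⟫ := by
  rw [inner_succ, left_bracket, right_bracket, component_apply, real_inner_smul_left,
    inner_mul_left, star_I, neg_mul, real_inner_smul_right, inner_sub_right,
    real_inner_smul_right, inner_neg_right]
  ring

theorem norm_bracket_sq (hε : ε * ε = 1) (p : A (n + 1)) : ‖bracket ε p‖ ^ 2 = 2 * ‖p‖ ^ 2 := by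
  rw [norm_sq_succ, left_bracket, right_bracket, norm_smul, mul_pow, norm_I_mul_sq,
    Real.norm_eq_abs, sq_abs, sq ε, hε]
  ring

theorem bracket_mul_bracket (ε δ : ℝ) (hp : p ∈ complexPerp n) (hx : x ∈ complexPerp n) :
    bracket ε p * bracket δ x = pair (p * x - (ε * δ) • (I * (star (p * x) * I)))
      ((δ • star (p * x) - ε • (p * x)) * I) := by
  have hIx : star (I * x) = -(I * x) := star_of_mem_complexPerp (I_mul_mem_complexPerp hx)
  refine ext_pair ?_ ?_
  · rw [left_mul, left_bracket, left_bracket, right_bracket, right_bracket, left_pair,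
      star_smul, hIx, smul_mul_smul_comm, neg_mul,
      mul_I_mul_of_mem_complexPerp (I_mul_mem_complexPerp hx) hp,
      I_mul_mul_of_mem_complexPerp hx hp, star_mul_of_mem_complexPerp hp hx, neg_neg, star_trivial,
      mul_comm δ]
  · rw [right_mul, left_bracket, left_bracket, right_bracket, right_bracket, right_pair,
      smul_mul_assoc, smul_mul_assoc, star_of_mem_complexPerp hx,
      I_mul_mul_of_mem_complexPerp hx hp, mul_neg, I_mul_mul_of_mem_complexPerp hp hx,
      star_mul_of_mem_complexPerp hp hx, sub_mul, smul_mul_assoc, smul_mul_assoc, smul_neg,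
      sub_eq_add_neg]

theorem bracket_mul_bracket_self (hε : ε * ε = 1) (hp : p ∈ complexPerp n)
    (hx : x ∈ complexPerp n) (hpx : p * x ∈ complexPerp n) :
    bracket ε p * bracket ε x = bracket ε ((2 : ℝ) • (p * x)) := by
  rw [bracket_mul_bracket _ _ hp hx, star_of_mem_complexPerp hpx, hε, neg_mul,
    mul_I_of_mem_complexPerp hpx, neg_neg, I_mul_I_mul]
  refine ext_pair ?_ ?_
  · simp only [left_pair, map_smul, left_smul, left_bracket]
    module
  · rw [right_pair, right_bracket, mul_smul_comm, sub_mul]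
    simp only [smul_mul_assoc, mul_I_of_mem_complexPerp hpx, neg_mul]
    module

theorem bracket_mul_bracket_neg (hε : ε * ε = 1) (hp : p ∈ complexPerp n)
    (hx : x ∈ complexPerp n) :
    bracket ε p * bracket (-ε) x =
      pair ((2 * re (right (p * x))) • I) (-((ε * (2 * re (p * x))) • I)) := by
  rw [bracket_mul_bracket _ _ hp hx]
  generalize p * x = z
  congr 1
  · rw [I_mul_mul_I, mul_neg, hε, neg_one_smul, sub_neg_eq_add]
    exact ext_pair (by simp) (by simp [← add_star_self])
  · rw [mul_smul, ← smul_one_mul (2 * re z), ← add_star_self, ← smul_mul_assoc, ← neg_mul]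
    congr 1
    module

theorem bracket_mul_bracket_neg_eq_zero (hε : ε * ε = 1) (hp : p ∈ complexPerp n)
    (hx : x ∈ complexPerp n) (hpx : p * x ∈ complexPerp n) :
    bracket ε p * bracket (-ε) x = 0 := by
  obtain ⟨hl, hr⟩ := mem_complexPerp.1 hpx
  rw [bracket_mul_bracket_neg hε hp hx, hl, hr, mul_zero, mul_zero, zero_smul, neg_zero]
  rfl

theorem bracket_mul_pair_I_zero (ε : ℝ) (hp : p ∈ complexPerp n) :
    bracket ε p * pair I 0 = -bracket (-ε) (I * p) := by
  refine ext_pair ?_ ?_ <;>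
    simp [mul_I_of_mem_complexPerp hp, star_I, smul_mul_assoc,
      mul_I_of_mem_complexPerp (I_mul_mem_complexPerp hp)]

theorem bracket_mul_pair_zero_I (hε : ε * ε = 1) (p : A (n + 1)) :
    bracket ε p * pair 0 I = -(ε • bracket (-ε) p) := by
  refine ext_pair ?_ ?_ <;>
    simp [star_I, mul_smul_comm, I_mul_I_mul, smul_smul, hε]

end Bracket

section BracketEigenspaces

variable {p x y : A (n + 1)} {w : A (n + 2)} {ε lam : ℝ}

theorem pair_I_zero_mem_Eig_one_bracket (hε : ε * ε = 1) (h0 : p ≠ 0) (hp : p ∈ complexPerp n) :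
    pair I 0 ∈ Eig 1 (bracket ε p) := by
  rw [mem_Eig_iff (bracket_ne_zero h0), star_of_mem_complexPerp (bracket_mem_complexPerp hp),
    bracket_mul_pair_I_zero ε hp, neg_mul_neg,
    bracket_mul_bracket_neg hε hp (I_mul_mem_complexPerp hp),
    mul_I_mul_self_of_mem_complexPerp hp, norm_bracket_sq hε]
  have hI : re (I : A (n + 1)) = 0 := re_zero
  refine ext_pair ?_ ?_ <;> simp [re_smul, hI]

theorem pair_zero_I_mem_Eig_one_bracket (hε : ε * ε = 1) (h0 : p ≠ 0) (hp : p ∈ complexPerp n) :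
    pair 0 I ∈ Eig 1 (bracket ε p) := by
  rw [mem_Eig_iff (bracket_ne_zero h0), star_of_mem_complexPerp (bracket_mem_complexPerp hp),
    bracket_mul_pair_zero_I hε, neg_mul_neg, mul_smul_comm,
    bracket_mul_bracket_neg hε hp hp, mul_self_of_mem_complexPerp hp, norm_bracket_sq hε]
  refine ext_pair ?_ ?_
  · simp [re_smul]
  · simp only [right_neg, right_smul, right_one, right_pair, smul_zero, neg_zero, re_zero, mul_zero,
      zero_smul, re_neg, re_smul, re_one]
    linear_combination (norm := module) (2 * ‖p‖ ^ 2 * hε) • (I : A (n + 1))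

theorem I_mul_bracket (hε : ε * ε = 1) (hp : p ∈ complexPerp n) :
    I * bracket ε p = ε • bracket ε (I * p) := by
  rw [I_mul]
  refine ext_pair ?_ ?_
  · simp [star_of_mem_complexPerp (I_mul_mem_complexPerp hp)]
  · simp [star_of_mem_complexPerp hp, I_mul_I_mul, smul_smul, hε]

theorem pair_zero_mem_and_pair_zero_I_mul_mem {S : Submodule ℝ (A (n + 2))} (hε : ε * ε = 1)
    (h : bracket ε p ∈ S) (h' : bracket (-ε) p ∈ S) : pair p 0 ∈ S ∧ pair 0 (I * p) ∈ S := by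
  have hadd : pair p 0 = (1 / 2 : ℝ) • (bracket ε p + bracket (-ε) p) :=
    ext_pair (by simp only [left_pair, left_add, left_smul, left_bracket]; module) (by simp)
  have hsub : pair 0 (I * p) = (ε / 2) • (bracket ε p - bracket (-ε) p) := by
    refine ext_pair (by simp) ?_
    simp only [right_pair, right_smul, right_sub, right_bracket]
    linear_combination (norm := module) (-hε) • (I * p)
  exact ⟨hadd ▸ S.smul_mem _ (S.add_mem h h'), hsub ▸ S.smul_mem _ (S.sub_mem h h')⟩

theorem pair_mem_Eig_one_bracket (hε : ε * ε = 1) (h0 : p ≠ 0) (hp : p ∈ complexPerp n)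
    (hx : x ∈ quat p) (hy : y ∈ quat p) : pair x y ∈ Eig 1 (bracket ε p) := by
  set b := bracket ε p
  have hb0 : b ≠ 0 := bracket_ne_zero h0
  have hb : b ∈ complexPerp (n + 1) := bracket_mem_complexPerp hp
  have hI0 : pair I 0 ∈ Eig 1 b := pair_I_zero_mem_Eig_one_bracket hε h0 hp
  have h0I : pair 0 I ∈ Eig 1 b := pair_zero_I_mem_Eig_one_bracket hε h0 hp
  have hε0 : ε ≠ 0 := left_ne_zero_of_mul_eq_one hε
  obtain ⟨h10, h01, hbp, hbIp⟩ := quat_le_iff.1 (quat_le_Eig_one hb0 hb)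
  rw [I_mul_bracket hε hp, smul_mem_iff _ hε0] at hbIp
  have hbp' := mul_mem_Eig (star_of_mem_complexPerp hb) h0I
  rw [bracket_mul_pair_zero_I hε, neg_mem_iff, smul_mem_iff _ hε0] at hbp'
  have hbIp' := mul_mem_Eig (star_of_mem_complexPerp hb) hI0
  rw [bracket_mul_pair_I_zero ε hp, neg_mem_iff] at hbIp'
  obtain ⟨hp0, h0Ip⟩ := pair_zero_mem_and_pair_zero_I_mul_mem hε hbp hbp'
  obtain ⟨hIp0, h0p⟩ := pair_zero_mem_and_pair_zero_I_mul_mem hε hbIp hbIp'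
  rw [I_mul_I_mul, show pair 0 (-p) = -pair 0 p from ext_pair (by simp) (by simp),
    neg_mem_iff] at h0p
  have hl : quat p ≤ (Eig 1 b).comap ((prodEquiv _).symm.toLinearMap ∘ₗ .inl ℝ _ _) :=
    quat_le_iff.2 ⟨h10, hI0, hp0, hIp0⟩
  have hr : quat p ≤ (Eig 1 b).comap ((prodEquiv _).symm.toLinearMap ∘ₗ .inr ℝ _ _) :=
    quat_le_iff.2 ⟨h01, h0I, h0p, h0Ip⟩
  have hxy : pair x y = pair x 0 + pair 0 y := ext_pair (by simp) (by simp)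
  rw [hxy]
  exact add_mem (hl hx) (hr hy)

theorem eight_le_finrank_Eig_one_bracket (hε : ε * ε = 1) (h0 : p ≠ 0) (hp : p ∈ complexPerp n) :
    8 ≤ finrank ℝ (Eig 1 (bracket ε p)) := by
  have h := finrank_add_finrank_le_of_pair_mem fun x hx y hy =>
    pair_mem_Eig_one_bracket hε h0 hp hx hy
  rwa [finrank_quat h0 hp] at h

theorem component_mem_orthogonal_quat (hε : ε * ε = 1) (h0 : p ≠ 0) (hp : p ∈ complexPerp n)
    (hlam : lam ≠ 1) (hw : w ∈ Eig lam (bracket ε p)) (δ : ℝ) : component δ w ∈ (quat p)ᗮ := by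
  have hortho : ∀ u ∈ Eig 1 (bracket ε p), ⟪u, w⟫ = 0 :=
    fun u hu => isOrtho_iff_inner_eq.1 (Eig_isOrtho hlam.symm) u hu w hw
  refine component_mem (fun x => I_mul_mem_orthogonal_quat hp) ?_ ?_ <;>
    refine (mem_orthogonal _ _).2 fun x hx => ?_
  · simpa [inner_succ] using hortho _ (pair_mem_Eig_one_bracket hε h0 hp hx (zero_mem _))
  · simpa [inner_succ] using hortho _ (pair_mem_Eig_one_bracket hε h0 hp (zero_mem _) hx)

theorem finrank_ker_L_bracket_add_four_le (hε : ε * ε = 1) (h0 : p ≠ 0)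
    (hp : p ∈ complexPerp n) :
    finrank ℝ (LinearMap.ker (L (bracket ε p))) + 4 ≤
      finrank ℝ (LinearMap.ker (L p)) + 2 ^ (n + 1) := by
  have hle : LinearMap.ker (L (bracket ε p)) ≤
      (LinearMap.ker (L p)).map (bracket ε) ⊔ (quat p)ᗮ.map (bracket (-ε)) := by
    intro w hw
    have hcomp := component_mem_orthogonal_quat hε h0 hp zero_ne_one
      (by rwa [Eig_zero_eq_ker (bracket_ne_zero h0)] : w ∈ Eig 0 (bracket ε p))
    rw [LinearMap.mem_ker, L_apply] at hw
    obtain ⟨hx, hpx⟩ := (mem_orthogonal_quat_iff hp).1 (hcomp ε)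
    obtain ⟨hy, hpy⟩ := (mem_orthogonal_quat_iff hp).1 (hcomp (-ε))
    rw [← bracket_component_add hε w, mul_add, bracket_mul_bracket_self hε hp hx hpx,
      bracket_mul_bracket_neg_eq_zero hε hp hy hpy, add_zero, bracket_eq_zero,
      smul_eq_zero_iff_right two_ne_zero] at hw
    rw [← bracket_component_add hε w]
    exact add_mem_sup (mem_map_of_mem (by rwa [LinearMap.mem_ker, L_apply]))
      (mem_map_of_mem (hcomp (-ε)))
  have hker := (finrank_mono hle).trans (finrank_add_le_finrank_add_finrank _ _)
  have hmap := finrank_map_le (bracket ε) (LinearMap.ker (L p))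
  have hmap_neg := finrank_map_le (bracket (-ε)) (quat p)ᗮ
  have hquat := (quat p).finrank_add_finrank_orthogonal
  rw [finrank_quat h0 hp, finrank_A] at hquat
  omega

theorem bracket_mem_Eig (hε : ε * ε = 1) (h0 : p ≠ 0) (hp : p ∈ complexPerp n)
    (hx : x ∈ Eig lam p) (hx' : x ∈ (quat p)ᗮ) : bracket ε x ∈ Eig (2 * lam) (bracket ε p) := by
  obtain ⟨hxC, hpx⟩ := (mem_orthogonal_quat_iff hp).1 hx'
  rw [mem_Eig_iff h0, star_of_mem_complexPerp hp, neg_mul, neg_eq_iff_eq_neg] at hx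
  have hppx : p * (p * x) ∈ complexPerp n := hx ▸ neg_mem (smul_mem _ _ hxC)
  rw [mem_Eig_iff (bracket_ne_zero h0), star_of_mem_complexPerp (bracket_mem_complexPerp hp),
    bracket_mul_bracket_self hε hp hxC hpx, map_smul, mul_smul_comm, neg_mul,
    bracket_mul_bracket_self hε hp hpx hppx, hx, norm_bracket_sq hε]
  simp only [map_smul, map_neg]
  module

theorem finrank_Eig_le_finrank_Eig_bracket (hε : ε * ε = 1) (h0 : p ≠ 0) (hp : p ∈ complexPerp n)
    (hlam : lam ≠ 1) : finrank ℝ (Eig lam p) ≤ finrank ℝ (Eig (2 * lam) (bracket ε p)) :=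
  finrank_le_finrank_of_injOn (fun _ hx => bracket_mem_Eig hε h0 hp hx
    (Eig_le_orthogonal hlam (quat_le_Eig_one h0 hp) hx)) (bracket_injective ε).injOn

theorem finrank_Eig_one_le_add_four (hε : ε * ε = 1) (h0 : p ≠ 0) (hp : p ∈ complexPerp n) :
    finrank ℝ (Eig 1 p) ≤ finrank ℝ (Eig 2 (bracket ε p)) + 4 := by
  have hmem : ∀ x ∈ Eig 1 p ⊓ (quat p)ᗮ, bracket ε x ∈ Eig 2 (bracket ε p) := fun x hx => by
    simpa using bracket_mem_Eig hε h0 hp hx.1 hx.2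
  have hle := finrank_le_finrank_of_injOn hmem (bracket_injective ε).injOn
  have hinf := finrank_le_finrank_inf_orthogonal_add (Eig 1 p) (quat p)
  rw [finrank_quat h0 hp] at hinf
  omega

end BracketEigenspaces

section KernelBounds

variable {p q x y : A (n + 1)} {a : A (n + 2)} {ε : ℝ}

theorem eq_zero_of_bracket_add_bracket_eq_zero (hε : ε * ε = 1)
    (h : bracket ε x + bracket (-ε) y = 0) : x = 0 ∧ y = 0 := by
  have hx : x = 0 := by rw [← component_bracket_add hε x y, h, map_zero]
  rw [hx, map_zero, zero_add, bracket_eq_zero] at h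
  exact ⟨hx, h⟩

theorem eq_zero_of_add_smul_I_eq_zero {r : ℝ} (hx : x ∈ complexPerp n) (h : x + r • I = 0) :
    r = 0 := by
  simpa [re_add, re_smul, (mem_complexPerp.1 hx).2] using
    congrArg (fun z => re (right z)) h

theorem mul_eq_zero_of_bracket_add_mul_bracket_add_eq_zero (hε : ε * ε = 1)
    (hp : p ∈ complexPerp n) (hq : q ∈ complexPerp n) (hx : x ∈ complexPerp n)
    (hy : y ∈ complexPerp n) (hpx : p * x ∈ complexPerp n) (hqy : q * y ∈ complexPerp n)
    (h : (bracket ε p + bracket (-ε) q) * (bracket ε x + bracket (-ε) y) = 0) :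
    p * x = 0 ∧ q * y = 0 := by
  have hε' : -ε * -ε = 1 := by rwa [neg_mul_neg]
  have hqx := bracket_mul_bracket_neg hε' hq hx
  rw [neg_neg] at hqx
  rw [add_mul, mul_add, mul_add, bracket_mul_bracket_self hε hp hx hpx,
    bracket_mul_bracket_neg hε hp hy, hqx, bracket_mul_bracket_self hε' hq hy hqy] at h
  obtain ⟨r, s, h⟩ : ∃ r s : ℝ, bracket ε ((2 : ℝ) • (p * x)) + bracket (-ε) ((2 : ℝ) • (q * y)) +
      pair (r • I) (s • I) = 0 := by
    refine ⟨2 * re (right (p * y)) + 2 * re (right (q * x)),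
      -(ε * (2 * re (p * y))) + ε * (2 * re (q * x)), h ▸ ext_pair ?_ ?_⟩
    · simp only [left_add, left_bracket, left_pair]
      module
    · simp only [right_add, right_bracket, right_pair]
      module
  have hz : (2 : ℝ) • (p * x) ∈ complexPerp n := smul_mem _ _ hpx
  have hz' : (2 : ℝ) • (q * y) ∈ complexPerp n := smul_mem _ _ hqy
  have hr : r = 0 := eq_zero_of_add_smul_I_eq_zero (add_mem hz hz') (congrArg left h)
  have hs : s = 0 := eq_zero_of_add_smul_I_eq_zero
    (add_mem (smul_mem _ ε (I_mul_mem_complexPerp hz))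
      (smul_mem _ (-ε) (I_mul_mem_complexPerp hz'))) (congrArg right h)
  rw [hr, hs, zero_smul, show pair 0 0 = (0 : A (n + 2)) from rfl, add_zero] at h
  simpa using eq_zero_of_bracket_add_bracket_eq_zero hε h

theorem finrank_ker_L_le_of_left_right_mem_complexPerp (ha : a ≠ 0)
    (hl : left a ∈ complexPerp n) (hr : right a ∈ complexPerp n) :
    finrank ℝ (LinearMap.ker (L a)) ≤ finrank ℝ (LinearMap.ker (L (component 1 a))) +
      finrank ℝ (LinearMap.ker (L (component (-1) a))) + 6 := by
  set p := component 1 a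
  set q := component (-1) a
  have hp : p ∈ complexPerp n := component_mem (fun _ => I_mul_mem_complexPerp) hl hr
  have hq : q ∈ complexPerp n := component_mem (fun _ => I_mul_mem_complexPerp) hl hr
  have hone : (1 : ℝ) * 1 = 1 := one_mul 1
  let v : Fin 6 → A (n + 2) := ![bracket 1 p, bracket 1 (I * p), bracket (-1) q,
    bracket (-1) (I * q), pair I 0, pair 0 I]
  have hle : LinearMap.ker (L a) ⊓ (span ℝ (Set.range v))ᗮ ≤
      (LinearMap.ker (L p)).map (bracket 1) ⊔ (LinearMap.ker (L q)).map (bracket (-1)) := by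
    rintro w ⟨hw, hwv⟩
    replace hw : a * w = 0 := hw
    obtain ⟨hw1, hwI⟩ := mem_complexPerp.1 (right_mem_complexPerp_of_mul_eq_zero ha hw)
    have hv := mem_orthogonal_span_range.1 hwv
    obtain ⟨hpx, hIpx, hqy, hIqy, hIl, hIr⟩ : ⟪p, component 1 w⟫ = 0 ∧
        ⟪I * p, component 1 w⟫ = 0 ∧ ⟪q, component (-1) w⟫ = 0 ∧ ⟪I * q, component (-1) w⟫ = 0 ∧
        re (right (left w)) = 0 ∧ re (right (right w)) = 0 := by
      simpa [Fin.forall_fin_succ, v, inner_bracket_left, inner_pair_left, inner_I_left] using hv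
    have hx (ε : ℝ) : component ε w ∈ complexPerp n :=
      component_mem (fun _ => I_mul_mem_complexPerp) (mem_complexPerp.2 ⟨by simpa using hw1, hIl⟩)
        (mem_complexPerp.2 ⟨hwI, hIr⟩)
    have hpx' : p * component 1 w ∈ complexPerp n := (mul_mem_complexPerp_iff hp).2 ⟨hpx, hIpx⟩
    have hqy' : q * component (-1) w ∈ complexPerp n := (mul_mem_complexPerp_iff hq).2 ⟨hqy, hIqy⟩
    rw [← bracket_component_add hone a, ← bracket_component_add hone w] at hw
    obtain ⟨hpx0, hqy0⟩ := mul_eq_zero_of_bracket_add_mul_bracket_add_eq_zero hone hp hq (hx 1)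
      (hx (-1)) hpx' hqy' hw
    rw [← bracket_component_add hone w]
    exact add_mem_sup (mem_map_of_mem hpx0) (mem_map_of_mem hqy0)
  have hinf := (finrank_mono hle).trans (finrank_add_le_finrank_add_finrank _ _)
  have hmap := finrank_map_le (bracket 1) (LinearMap.ker (L p))
  have hmap_neg := finrank_map_le (bracket (-1)) (LinearMap.ker (L q))
  have hker := finrank_le_finrank_inf_orthogonal_add (LinearMap.ker (L a)) (span ℝ (Set.range v))
  have hspan : finrank ℝ (span ℝ (Set.range v)) ≤ 6 := finrank_range_le_card v
  omega

theorem finrank_ker_L_lt_of_not_left_right_mem_complexPerp (ha : a ≠ 0)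
    (h : ¬(left a ∈ complexPerp n ∧ right a ∈ complexPerp n)) :
    finrank ℝ (LinearMap.ker (L a)) < 2 ^ (n + 1) := by
  have hinj : Set.InjOn (leftLm (n + 1)) (LinearMap.ker (L a)) := by
    refine LinearMap.injOn_of_disjoint_ker le_rfl (disjoint_def.2 fun w hw hlw => ?_)
    have hlw' : left w = 0 := hlw
    have hw' : a * w = 0 := hw
    refine ext_pair hlw' (not_not.1 fun hrw => h ⟨?_, ?_⟩)
    · exact right_mem_complexPerp_of_mul_eq_zero hrw (by simpa [hlw'] using congrArg right hw')
    · refine right_mem_complexPerp_of_mul_eq_zero (star_ne_zero.2 hrw) ?_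
      simpa [hlw'] using congrArg left hw'
  have hmem : ∀ w ∈ LinearMap.ker (L a), leftLm (n + 1) w ∈ (span ℝ {(1 : A (n + 1))})ᗮ := by
    intro w hw
    rw [mem_orthogonal_singleton_iff_inner_left, inner_one_right, leftLm_apply, re_left]
    exact (mem_complexPerp.1 (right_mem_complexPerp_of_mul_eq_zero ha hw)).1
  have hle := finrank_le_finrank_of_injOn hmem hinj
  have hone := (span ℝ {(1 : A (n + 1))}).finrank_add_finrank_orthogonal
  rw [finrank_span_singleton one_ne_zero, finrank_A] at hone
  omega

end KernelBounds

section SmallAlgebras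

theorem mul_comm_of_one (x y : A 1) : x * y = y * x := by
  have hcomm : ∀ s t : A 0, s * t = t * s := mul_comm (G := ℝ)
  have hstar : ∀ s : A 0, star s = s := fun _ => rfl
  refine ext_pair ?_ ?_ <;> simp only [left_mul, right_mul, hstar]
  · rw [hcomm (left x), hcomm (right y)]
  · rw [add_comm]

theorem mul_assoc_of_comm (hcomm : ∀ x y : A n, x * y = y * x)
    (hassoc : ∀ x y z : A n, x * y * z = x * (y * z)) (x y z : A (n + 1)) :
    x * y * z = x * (y * z) := by
  have hleft : ∀ x y z : A n, x * (y * z) = y * (x * z) := fun x y z => by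
    rw [← hassoc, hcomm x, hassoc]
  refine ext_pair ?_ ?_ <;>
    simp only [left_mul, right_mul, star_sub, star_add, star_mul, star_star, mul_add, mul_sub,
      add_mul, hassoc, hcomm, hleft] <;> abel

theorem star_mul_mul_of_assoc (hassoc : ∀ x y z : A n, x * y * z = x * (y * z))
    (x y : A (n + 1)) : star x * (x * y) = ‖x‖ ^ 2 • y := by
  have hu : ∀ u v : A n, u * (star u * v) = ‖u‖ ^ 2 • v := fun u v => by
    rw [← hassoc, self_mul_star, smul_one_mul]
  have hu' : ∀ u v : A n, star u * (u * v) = ‖u‖ ^ 2 • v := fun u v => by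
    rw [← hassoc, star_mul_self, smul_one_mul]
  refine ext_pair ?_ ?_ <;>
    simp only [left_mul, right_mul, left_star, right_star, star_sub, star_add, star_mul, star_star,
      add_mul, mul_sub, neg_mul, mul_neg, hassoc, hu, hu', self_mul_star, star_mul_self,
      mul_smul_comm, mul_one, norm_sq_succ, left_smul, right_smul] <;> module

theorem star_mul_mul_of_three (x y : A 3) : star x * (x * y) = ‖x‖ ^ 2 • y :=
  star_mul_mul_of_assoc (mul_assoc_of_comm mul_comm_of_one <|
    mul_assoc_of_comm (mul_comm (G := ℝ)) (mul_assoc (G := ℝ))) x y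

theorem mul_mul_star_of_three (x y : A 3) : y * x * star x = ‖x‖ ^ 2 • y := by
  simpa [norm_star_sq] using congrArg star (star_mul_mul_of_three (star x) (star y))

theorem Eig_one_eq_top_of_three {a : A 3} (ha : a ≠ 0) : Eig 1 a = ⊤ :=
  eq_top_iff.2 fun x _ => by rw [mem_Eig_iff ha, one_mul, star_mul_mul_of_three]

theorem mul_mul_self_left_of_three (x y : A 3) : x * (x * y) = x * x * y := by
  have h := star_mul_mul_of_three x y
  rw [star_eq_sub, sub_mul, smul_one_mul] at h
  rw [mul_self_eq, sub_mul, smul_mul_assoc, smul_one_mul, ← h]; abel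

theorem mul_mul_self_right_of_three (x y : A 3) : y * x * x = y * (x * x) := by
  simpa using congrArg star (mul_mul_self_left_of_three (star x) (star y))

/-- The associator `(u z) v - u (z v)`, as a linear map in its middle argument `z`. -/
noncomputable def midAssociator (u v : A n) : A n →ₗ[ℝ] A n :=
  LinearMap.mulRight ℝ v ∘ₗ L u - L u ∘ₗ LinearMap.mulRight ℝ v

@[simp] theorem midAssociator_apply (u v z : A n) : midAssociator u v z = u * z * v - u * (z * v) :=
  rfl

theorem midAssociator_self (u : A 3) : midAssociator u u = 0 := by
  ext z
  have h := mul_mul_self_left_of_three (u + z) u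
  simp only [mul_add, add_mul] at h
  rw [midAssociator_apply, LinearMap.zero_apply]
  linear_combination (norm := module) mul_mul_self_left_of_three u u +
    mul_mul_self_left_of_three z u - h - mul_mul_self_right_of_three u z

theorem midAssociator_swap (u v z : A 3) : midAssociator v u z = -midAssociator u v z := by
  have h := LinearMap.congr_fun (midAssociator_self (u + v)) z
  have hu := LinearMap.congr_fun (midAssociator_self u) z
  have hv := LinearMap.congr_fun (midAssociator_self v) z
  simp only [midAssociator_apply, LinearMap.zero_apply, add_mul, mul_add] at *
  linear_combination (norm := module) h - hu - hv

theorem mul_mem_span_one_self {u s t : A n} (hs : s ∈ span ℝ {1, u}) (ht : t ∈ span ℝ {1, u}) :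
    s * t ∈ span ℝ {1, u} := by
  obtain ⟨a, b, rfl⟩ := mem_span_pair.1 hs
  obtain ⟨c, d, rfl⟩ := mem_span_pair.1 ht
  refine mem_span_pair.2 ⟨a * c - b * d * ‖u‖ ^ 2, a * d + b * c + b * d * (2 * re u), ?_⟩
  simp only [add_mul, mul_add, smul_mul_assoc, mul_smul_comm, one_mul, mul_one, mul_self_eq u]
  module

theorem star_mem_span_one_self {u s : A n} (hs : s ∈ span ℝ {1, u}) :
    star s ∈ span ℝ {1, u} := by
  rw [star_eq_sub]
  exact sub_mem (smul_mem _ _ (subset_span (Set.mem_insert _ _))) hs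

theorem midAssociator_eq_zero_of_mem_span_one_self {u v : A 3} (hv : v ∈ span ℝ {1, u}) :
    midAssociator u v = 0 := by
  obtain ⟨r, s, rfl⟩ := mem_span_pair.1 hv
  ext z
  have h := LinearMap.congr_fun (midAssociator_self u) z
  simp only [midAssociator_apply, LinearMap.zero_apply, mul_add, mul_smul_comm, mul_one] at h ⊢
  linear_combination (norm := module) s • h

theorem add_mul_mem_ker_midAssociator {u v s t : A 3} (hs : s ∈ span ℝ {1, u})
    (ht : t ∈ span ℝ {1, u}) : s + t * v ∈ LinearMap.ker (midAssociator u v) := by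
  obtain ⟨a, b, rfl⟩ := mem_span_pair.1 hs
  obtain ⟨c, d, rfl⟩ := mem_span_pair.1 ht
  simp only [LinearMap.mem_ker, midAssociator_apply, add_mul, mul_add, smul_mul_assoc,
    mul_smul_comm, one_mul, mul_one, mul_mul_self_left_of_three, mul_mul_self_right_of_three]
  module

theorem mem_span_one_self_of_add_mul_eq_zero {u v s t : A 3} (hs : s ∈ span ℝ {1, u})
    (ht : t ∈ span ℝ {1, u}) (ht0 : t ≠ 0) (h : s + t * v = 0) : v ∈ span ℝ {1, u} := by
  have hv : ‖t‖ ^ 2 • v = -(star t * s) := by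
    rw [← star_mul_mul_of_three, ← mul_neg, eq_neg_of_add_eq_zero_right h]
  rw [← smul_mem_iff _ (pow_ne_zero 2 (norm_ne_zero_iff.2 ht0)), hv, neg_mem_iff]
  exact mul_mem_span_one_self (star_mem_span_one_self ht) hs

theorem four_le_finrank_ker_midAssociator (u v : A 3) :
    4 ≤ finrank ℝ (LinearMap.ker (midAssociator u v)) := by
  by_cases h0 : midAssociator u v = 0
  · rw [h0, LinearMap.ker_zero, finrank_top, finrank_A]
    norm_num
  have hv : v ∉ span ℝ {1, u} := fun hv => h0 (midAssociator_eq_zero_of_mem_span_one_self hv)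
  have hu : ∀ r : ℝ, r • (1 : A 3) ≠ u := by
    rintro r rfl
    exact h0 (LinearMap.ext fun z => by
      simp only [midAssociator_apply, smul_mul_assoc, one_mul, sub_self, LinearMap.zero_apply])
  have hS : finrank ℝ (span ℝ {1, u}) = 2 := by
    have hcard := finrank_span_eq_card ((LinearIndependent.pair_iff' one_ne_zero).2 hu)
    rwa [Matrix.range_cons_cons_empty, Fintype.card_fin] at hcard
  let f : span ℝ {1, u} × span ℝ {1, u} →ₗ[ℝ] A 3 :=
    (span ℝ {1, u}).subtype.coprod (LinearMap.mulRight ℝ v ∘ₗ (span ℝ {1, u}).subtype)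
  have hf : Function.Injective f := by
    refine (injective_iff_map_eq_zero f).2 fun ⟨⟨s, hs⟩, ⟨t, ht⟩⟩ h => ?_
    have h' : s + t * v = 0 := h
    have ht0 : t = 0 :=
      not_not.1 fun ht0 => hv (mem_span_one_self_of_add_mul_eq_zero hs ht ht0 h')
    simpa [ht0] using h'
  have hle := LinearMap.finrank_le_finrank_of_injective
    (f := f.codRestrict (LinearMap.ker (midAssociator u v)) fun z =>
      add_mul_mem_ker_midAssociator z.1.2 z.2.2) ((Set.injective_codRestrict _).2 hf)
  rwa [finrank_prod, hS] at hle

end SmallAlgebras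

section Sedenions

theorem midAssociator_star_left (u v : A n) : midAssociator (star u) v = -midAssociator u v := by
  ext z
  simp only [star_eq_sub u, midAssociator_apply, LinearMap.neg_apply, sub_mul, smul_mul_assoc,
    one_mul]
  abel

theorem midAssociator_star_right (u v : A n) : midAssociator u (star v) = -midAssociator u v := by
  ext z
  simp only [star_eq_sub v, midAssociator_apply, LinearMap.neg_apply, mul_sub, mul_smul_comm,
    mul_one]
  abel

theorem midAssociator_star_apply (u v z : A n) :
    midAssociator u v (star z) = -midAssociator u v z := by
  simp only [star_eq_sub z, midAssociator_apply, mul_sub, sub_mul, mul_smul_comm, smul_mul_assoc,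
    mul_one, one_mul]
  abel

theorem star_mul_mul_of_four (a w : A 4) :
    star a * (a * w) = ‖a‖ ^ 2 • w + pair (midAssociator (left a) (right a) (right w))
      (-midAssociator (left a) (right a) (left w)) := by
  have hleft : midAssociator (left a) (right a) (right w) =
      midAssociator (star (left a)) (right a) (star (right w)) := by
    rw [midAssociator_star_left, LinearMap.neg_apply, midAssociator_star_apply, neg_neg]
  have hright : -midAssociator (left a) (right a) (left w) =
      midAssociator (right a) (star (left a)) (star (left w)) := by
    rw [midAssociator_star_right, LinearMap.neg_apply, midAssociator_star_apply, midAssociator_swap,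
      neg_neg]
  have hr := star_mul_mul_of_three (star (right a)) (right w)
  have hr' := mul_mul_star_of_three (star (right a)) (left w)
  rw [star_star, norm_star_sq] at hr hr'
  rw [hleft, hright]
  refine ext_pair ?_ ?_ <;>
    simp only [left_mul, right_mul, left_star, right_star, star_add, star_sub, star_mul, star_star,
      left_add, right_add, left_smul, right_smul, left_pair, right_pair, midAssociator_apply,
      mul_sub, add_mul, mul_neg, neg_mul, star_mul_mul_of_three, mul_mul_star_of_three, hr, hr',
      norm_sq_succ] <;> module

variable {a w : A 4} {lam : ℝ}

theorem mem_Eig_iff_of_four (ha : a ≠ 0) : w ∈ Eig lam a ↔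
    midAssociator (left a) (right a) (right w) = ((lam - 1) * ‖a‖ ^ 2) • left w ∧
    midAssociator (left a) (right a) (left w) = ((1 - lam) * ‖a‖ ^ 2) • right w := by
  have hsub : (lam * ‖a‖ ^ 2) • w - ‖a‖ ^ 2 • w = ((lam - 1) * ‖a‖ ^ 2) • w := by module
  rw [mem_Eig_iff ha, star_mul_mul_of_four, ← eq_sub_iff_add_eq', hsub, ← neg_sub lam 1, neg_mul,
    neg_smul, ← neg_eq_iff_eq_neg]
  exact ⟨fun h => ⟨congrArg left h, congrArg right h⟩, fun h => ext_pair h.1 h.2⟩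

theorem eight_le_finrank_Eig_one_of_four (ha : a ≠ 0) : 8 ≤ finrank ℝ (Eig 1 a) := by
  have hker := four_le_finrank_ker_midAssociator (left a) (right a)
  have hmem : ∀ x ∈ LinearMap.ker (midAssociator (left a) (right a)),
      ∀ y ∈ LinearMap.ker (midAssociator (left a) (right a)), pair x y ∈ Eig 1 a := by
    intro x hx y hy
    rw [mem_Eig_iff_of_four ha, sub_self, zero_mul, zero_smul, zero_smul]
    exact ⟨hy, hx⟩
  have hle : _ ≤ finrank ℝ (Eig 1 a) := finrank_add_finrank_le_of_pair_mem hmem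
  omega

/-- The reflection `(x, y) ↦ (x, -y)` of `A (n + 1)`. In `A 4` it exchanges the eigenspaces of
`lam` and `2 - lam`. -/
noncomputable def reflection (n : ℕ) : A (n + 1) →ₗ[ℝ] A (n + 1) where
  toFun w := pair (left w) (-right w)
  map_add' x y := by
    refine ext_pair rfl ?_
    simp only [right_pair, right_add, neg_add]
  map_smul' r x := by
    refine ext_pair rfl ?_
    simp only [right_pair, right_smul, RingHom.id_apply, smul_neg]

theorem reflection_injective (n : ℕ) : Function.Injective (reflection n) := fun x y h =>
  have hl : left (reflection n x) = left (reflection n y) := congrArg left h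
  have hr : right (reflection n x) = right (reflection n y) := congrArg right h
  ext_pair hl (neg_injective hr)

theorem reflection_mem_Eig_of_four (ha : a ≠ 0) (hw : w ∈ Eig lam a) :
    reflection 3 w ∈ Eig (2 - lam) a := by
  obtain ⟨hl, hr⟩ := (mem_Eig_iff_of_four ha).1 hw
  refine (mem_Eig_iff_of_four ha).2 ⟨(map_neg _ _).trans ?_, hr.trans ?_⟩
  · rw [hl]
    change _ = _ • left w
    module
  · change _ = _ • -right w
    module

theorem finrank_Eig_zero_le_finrank_Eig_two_of_four (ha : a ≠ 0) :
    finrank ℝ (Eig 0 a) ≤ finrank ℝ (Eig 2 a) :=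
  finrank_le_finrank_of_injOn
    (fun w hw => by simpa only [sub_zero] using reflection_mem_Eig_of_four ha hw)
    (reflection_injective 3).injOn

theorem finrank_Eig_zero_le_of_four (ha : a ≠ 0) : finrank ℝ (Eig 0 a) ≤ 4 := by
  have hone := eight_le_finrank_Eig_one_of_four ha
  have htwo := finrank_Eig_zero_le_finrank_Eig_two_of_four ha
  have hsum : ∑ r ∈ {0, 1, 2}, finrank ℝ (Eig r a) ≤ finrank ℝ (A 4) :=
    sum_finrank_le_of_iSupIndep (End.eigenspaces_iSupIndep (M a)) _
  rw [Finset.sum_insert (by norm_num), Finset.sum_insert (by norm_num), Finset.sum_singleton,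
    finrank_A] at hsum
  omega

end Sedenions

section TopDimensional

theorem four_mul_le_two_pow (hn : 4 ≤ n) : 4 * n ≤ 2 ^ n := by
  induction n, hn using Nat.le_induction with
  | base => norm_num
  | succ n hn ih => rw [pow_succ]; omega

theorem exists_eq_bracket_of_le_finrank_ker_L (hn : 3 ≤ n)
    (hle : ∀ p : A (n + 1), p ≠ 0 →
      finrank ℝ (LinearMap.ker (L p)) + 4 * (n + 1) ≤ 2 ^ (n + 1) + 4)
    {a : A (n + 2)} (ha : a ≠ 0)
    (h : 2 ^ (n + 2) + 4 ≤ finrank ℝ (LinearMap.ker (L a)) + 4 * (n + 2)) :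
    ∃ (ε : ℝ) (p : A (n + 1)), ε * ε = 1 ∧ p ≠ 0 ∧ p ∈ complexPerp n ∧ a = bracket ε p := by
  have hpow := four_mul_le_two_pow (n := n + 1) (by omega)
  rw [pow_succ 2 (n + 1)] at h
  by_cases hperp : left a ∈ complexPerp n ∧ right a ∈ complexPerp n
  · obtain ⟨hl, hr⟩ := hperp
    have hcomp (ε : ℝ) : component ε a ∈ complexPerp n :=
      component_mem (fun _ => I_mul_mem_complexPerp) hl hr
    have hdec := bracket_component_add (one_mul (1 : ℝ)) a
    by_cases hp0 : component 1 a = 0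
    · rw [hp0, map_zero, zero_add] at hdec
      refine ⟨-1, component (-1) a, by norm_num, fun hq0 => ha ?_, hcomp _, hdec.symm⟩
      rw [← hdec, hq0, map_zero]
    by_cases hq0 : component (-1) a = 0
    · rw [hq0, map_zero, add_zero] at hdec
      exact ⟨1, component 1 a, one_mul 1, hp0, hcomp _, hdec.symm⟩
    have hsum := finrank_ker_L_le_of_left_right_mem_complexPerp ha hl hr
    have hp := hle _ hp0
    have hq := hle _ hq0
    omega
  · have hlt := finrank_ker_L_lt_of_not_left_right_mem_complexPerp ha hperp
    omega

theorem finrank_ker_L_add_four_mul_le_succ (hn : 3 ≤ n)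
    (hle : ∀ p : A (n + 1), p ≠ 0 →
      finrank ℝ (LinearMap.ker (L p)) + 4 * (n + 1) ≤ 2 ^ (n + 1) + 4)
    {a : A (n + 2)} (ha : a ≠ 0) :
    finrank ℝ (LinearMap.ker (L a)) + 4 * (n + 2) ≤ 2 ^ (n + 2) + 4 := by
  by_contra! hlt
  obtain ⟨ε, p, hε, hp0, hp, rfl⟩ := exists_eq_bracket_of_le_finrank_ker_L hn hle ha hlt.le
  have hker := finrank_ker_L_bracket_add_four_le hε hp0 hp
  have hker_p := hle p hp0
  rw [pow_succ 2 (n + 1)] at hlt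
  omega

theorem finrank_ker_L_add_four_mul_le (hn : 4 ≤ n) {a : A n} (ha : a ≠ 0) :
    finrank ℝ (LinearMap.ker (L a)) + 4 * n ≤ 2 ^ n + 4 := by
  induction n, hn using Nat.le_induction with
  | base =>
    rw [← Eig_zero_eq_ker ha]
    exact Nat.add_le_add_right (finrank_Eig_zero_le_of_four ha) 16
  | succ n hn ih =>
    obtain ⟨m, rfl⟩ := Nat.exists_eq_add_of_le' (show 1 ≤ n by omega)
    exact finrank_ker_L_add_four_mul_le_succ (by omega) (fun _ => ih) ha

theorem isTopDimZeroDivisor_iff {a : A n} : IsTopDimZeroDivisor a ↔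
    a ≠ 0 ∧ finrank ℝ (LinearMap.ker (L a)) + 4 * n = 2 ^ n + 4 := by
  refine and_congr_right fun ha => ?_
  rw [Eig_zero_eq_ker ha]
  zify
  constructor <;> intro h <;> linarith

namespace IsTopDimZeroDivisor

theorem exists_eq_bracket (hn : 3 ≤ n) {a : A (n + 2)} (h : IsTopDimZeroDivisor a) :
    ∃ (ε : ℝ) (p : A (n + 1)), ε * ε = 1 ∧ IsTopDimZeroDivisor p ∧ p ∈ complexPerp n ∧
      a = bracket ε p := by
  obtain ⟨ha, hdim⟩ := isTopDimZeroDivisor_iff.1 h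
  obtain ⟨ε, p, hε, hp0, hp, rfl⟩ := exists_eq_bracket_of_le_finrank_ker_L hn
    (fun _ => finrank_ker_L_add_four_mul_le (by omega)) ha hdim.ge
  have hker := finrank_ker_L_bracket_add_four_le hε hp0 hp
  have hle := finrank_ker_L_add_four_mul_le (by omega) hp0
  rw [pow_succ 2 (n + 1)] at hdim
  exact ⟨ε, p, hε, isTopDimZeroDivisor_iff.2 ⟨hp0, by omega⟩, hp, rfl⟩

theorem eight_le_finrank_Eig_one (hn : 3 ≤ n) {a : A n} (h : IsTopDimZeroDivisor a) :
    8 ≤ finrank ℝ (Eig 1 a) := by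
  obtain rfl | rfl | ⟨m, hm, rfl⟩ : n = 3 ∨ n = 4 ∨ ∃ m, 3 ≤ m ∧ n = m + 2 := by
    obtain ⟨m, rfl⟩ := Nat.exists_eq_add_of_le' (show 2 ≤ n by omega)
    by_cases hm : 3 ≤ m
    · exact Or.inr (Or.inr ⟨m, hm, rfl⟩)
    · omega
  · rw [Eig_one_eq_top_of_three h.1, finrank_top, finrank_A]
    norm_num
  · exact eight_le_finrank_Eig_one_of_four h.1
  · obtain ⟨ε, p, hε, hp, hperp, rfl⟩ := h.exists_eq_bracket hm
    exact eight_le_finrank_Eig_one_bracket hε hp.1 hperp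

theorem four_le_finrank_Eig_two (hn : 4 ≤ n) {a : A n} (h : IsTopDimZeroDivisor a) :
    4 ≤ finrank ℝ (Eig 2 a) := by
  obtain rfl | ⟨m, hm, rfl⟩ : n = 4 ∨ ∃ m, 3 ≤ m ∧ n = m + 2 := by
    obtain ⟨m, rfl⟩ := Nat.exists_eq_add_of_le' (show 2 ≤ n by omega)
    by_cases hm : 3 ≤ m
    · exact Or.inr ⟨m, hm, rfl⟩
    · omega
  · have hdim := (isTopDimZeroDivisor_iff.1 h).2
    rw [← Eig_zero_eq_ker h.1] at hdim
    have hle := finrank_Eig_zero_le_finrank_Eig_two_of_four h.1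
    omega
  · obtain ⟨ε, p, hε, hp, hperp, rfl⟩ := h.exists_eq_bracket hm
    have hone := hp.eight_le_finrank_Eig_one (by omega)
    have htwo := finrank_Eig_one_le_add_four hε hp.1 hperp
    omega

theorem four_le_finrank_Eig_two_pow {k : ℕ} (hk : k + 4 ≤ n) {a : A n}
    (h : IsTopDimZeroDivisor a) : 4 ≤ finrank ℝ (Eig (2 ^ (k + 1)) a) := by
  induction k generalizing n with
  | zero =>
    rw [zero_add, pow_one]
    exact h.four_le_finrank_Eig_two hk
  | succ k ih =>
    obtain ⟨m, rfl⟩ := Nat.exists_eq_add_of_le' (show 2 ≤ n by omega)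
    obtain ⟨ε, p, hε, hp, hperp, rfl⟩ := h.exists_eq_bracket (by omega)
    rw [pow_succ' 2 (k + 1)]
    exact (ih (by omega) hp).trans (finrank_Eig_le_finrank_Eig_bracket hε hp.1 hperp
      (one_lt_pow₀ one_lt_two k.succ_ne_zero).ne')

end IsTopDimZeroDivisor

/-- The eigenvalues of `M a` for `a` a top-dimensional zero-divisor of `A n`. -/
noncomputable def topDimSpectrum (n : ℕ) : Finset ℝ :=
  (if 4 ≤ n then {0} else ∅) ∪ (Finset.range (n - 2)).image (2 ^ ·)

/-- The multiplicity of `r ∈ topDimSpectrum n`. The natural subtraction is exact, since `4 ≤ n`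
when `0` is in the spectrum. -/
noncomputable def topDimMultiplicity (n : ℕ) (r : ℝ) : ℕ :=
  if r = 0 then 2 ^ n + 4 - 4 * n else if r = 1 then 8 else 4

theorem mem_topDimSpectrum_iff (hn : 3 ≤ n) {r : ℝ} :
    r ∈ topDimSpectrum n ↔ (r = 0 ∧ 4 ≤ n) ∨ ∃ k ≤ n - 3, r = 2 ^ k := by
  have hzero : r ∈ (if 4 ≤ n then {0} else ∅ : Finset ℝ) ↔ r = 0 ∧ 4 ≤ n := by
    split_ifs with h <;> simp [h]
  have hk : ∀ k, k < n - 2 ↔ k ≤ n - 3 := by omega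
  simp only [topDimSpectrum, Finset.mem_union, hzero, Finset.mem_image, Finset.mem_range, hk,
    eq_comm (a := (2 : ℝ) ^ _)]

theorem topDimMultiplicity_zero : topDimMultiplicity n 0 = 2 ^ n + 4 - 4 * n := if_pos rfl

theorem topDimMultiplicity_one : topDimMultiplicity n 1 = 8 :=
  (if_neg one_ne_zero).trans (if_pos rfl)

theorem topDimMultiplicity_of_ne {r : ℝ} (h0 : r ≠ 0) (h1 : r ≠ 1) : topDimMultiplicity n r = 4 :=
  (if_neg h0).trans (if_neg h1)

theorem topDimMultiplicity_two_pow_succ (n k : ℕ) : topDimMultiplicity n (2 ^ (k + 1)) = 4 :=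
  topDimMultiplicity_of_ne (pow_ne_zero _ two_ne_zero)
    (one_lt_pow₀ one_lt_two k.succ_ne_zero).ne'

theorem topDimMultiplicity_ne_zero (hn : 3 ≤ n) {r : ℝ} (hr : r ∈ topDimSpectrum n) :
    topDimMultiplicity n r ≠ 0 := by
  obtain ⟨rfl, h4⟩ | ⟨_ | k, -, rfl⟩ := (mem_topDimSpectrum_iff hn).1 hr
  · have hle := four_mul_le_two_pow h4
    rw [topDimMultiplicity_zero]
    omega
  · rw [pow_zero, topDimMultiplicity_one]
    norm_num
  · rw [topDimMultiplicity_two_pow_succ]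
    norm_num

theorem sum_topDimMultiplicity (hn : 3 ≤ n) :
    ∑ r ∈ topDimSpectrum n, topDimMultiplicity n r = 2 ^ n := by
  have hinj : Function.Injective fun k : ℕ => (2 : ℝ) ^ k :=
    pow_right_injective₀ two_pos (by norm_num)
  have hdisj : Disjoint (if 4 ≤ n then {0} else ∅)
      ((Finset.range (n - 2)).image ((2 : ℝ) ^ ·)) := by
    split_ifs <;> simp
  have hzero : ∑ r ∈ if 4 ≤ n then {0} else ∅, topDimMultiplicity n r + 4 * n = 2 ^ n + 4 := by
    split_ifs with h4
    · have hle := four_mul_le_two_pow h4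
      rw [Finset.sum_singleton, topDimMultiplicity_zero]
      omega
    · obtain rfl : n = 3 := by omega
      rfl
  have hpow : ∑ k ∈ Finset.range (n - 2), topDimMultiplicity n (2 ^ k) = (n - 3) * 4 + 8 := by
    rw [show n - 2 = n - 3 + 1 by omega, Finset.sum_range_succ', pow_zero, topDimMultiplicity_one,
      Finset.sum_congr rfl fun k _ => topDimMultiplicity_two_pow_succ n k, Finset.sum_const,
      Finset.card_range, smul_eq_mul]
  rw [topDimSpectrum, Finset.sum_union hdisj, Finset.sum_image hinj.injOn, hpow]
  omega

namespace IsTopDimZeroDivisor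

variable {a : A n} {r : ℝ}

theorem topDimMultiplicity_le_finrank_Eig (hn : 3 ≤ n) (h : IsTopDimZeroDivisor a)
    (hr : r ∈ topDimSpectrum n) : topDimMultiplicity n r ≤ finrank ℝ (Eig r a) := by
  obtain ⟨rfl, -⟩ | ⟨_ | k, hk, rfl⟩ := (mem_topDimSpectrum_iff hn).1 hr
  · have hdim := (isTopDimZeroDivisor_iff.1 h).2
    rw [topDimMultiplicity_zero, Eig_zero_eq_ker h.1]
    omega
  · rw [pow_zero, topDimMultiplicity_one]
    exact h.eight_le_finrank_Eig_one hn
  · rw [topDimMultiplicity_two_pow_succ]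
    exact h.four_le_finrank_Eig_two_pow (by omega)

theorem finrank_Eig_eq_and_mem_of_hasEigenvalue (hn : 3 ≤ n) (h : IsTopDimZeroDivisor a) :
    (∀ r ∈ topDimSpectrum n, finrank ℝ (Eig r a) = topDimMultiplicity n r) ∧
      ∀ r, End.HasEigenvalue (M a) r → r ∈ topDimSpectrum n :=
  finrank_eigenspace_eq_of_finrank_le_sum (fun _ => h.topDimMultiplicity_le_finrank_Eig hn)
    (by rw [sum_topDimMultiplicity hn, finrank_A])

theorem finrank_Eig_eq (hn : 3 ≤ n) (h : IsTopDimZeroDivisor a) (hr : r ∈ topDimSpectrum n) :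
    finrank ℝ (Eig r a) = topDimMultiplicity n r :=
  (h.finrank_Eig_eq_and_mem_of_hasEigenvalue hn).1 r hr

theorem hasEigenvalue_iff (hn : 3 ≤ n) (h : IsTopDimZeroDivisor a) :
    End.HasEigenvalue (M a) r ↔ r ∈ topDimSpectrum n := by
  refine ⟨(h.finrank_Eig_eq_and_mem_of_hasEigenvalue hn).2 r, fun hr hbot => ?_⟩
  rw [← finrank_eq_zero (R := ℝ)] at hbot
  exact topDimMultiplicity_ne_zero hn hr ((h.finrank_Eig_eq hn hr).symm.trans hbot)

end IsTopDimZeroDivisor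

end TopDimensional

end CayleyDickson

theorem mainTheorem1 (n : ℕ) (hn : 3 ≤ n) (a : CayleyDickson.A n)
    (ha : CayleyDickson.IsTopDimZeroDivisor a) :
    (∀ lam : ℝ, Module.End.HasEigenvalue (CayleyDickson.M a) lam ↔
      (lam = 0 ∧ 4 ≤ n) ∨ ∃ k : ℕ, k ≤ n - 3 ∧ lam = 2 ^ k) ∧
    (Module.finrank ℝ (CayleyDickson.Eig 0 a) : ℤ) = 2 ^ n - 4 * n + 4 ∧
    Module.finrank ℝ (CayleyDickson.Eig 1 a) = 8 ∧
    (∀ lam : ℝ, Module.End.HasEigenvalue (CayleyDickson.M a) lam → lam ≠ 0 → lam ≠ 1 →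
      Module.finrank ℝ (CayleyDickson.Eig lam a) = 4) := by
  have hspec : ∀ lam : ℝ, Module.End.HasEigenvalue (CayleyDickson.M a) lam ↔
      lam ∈ CayleyDickson.topDimSpectrum n := fun _ => ha.hasEigenvalue_iff hn
  have hone : (1 : ℝ) ∈ CayleyDickson.topDimSpectrum n :=
    (CayleyDickson.mem_topDimSpectrum_iff hn).2 (Or.inr ⟨0, zero_le, (pow_zero 2).symm⟩)
  refine ⟨fun lam => (hspec lam).trans (CayleyDickson.mem_topDimSpectrum_iff hn), ha.2, ?_,
    fun lam hlam h0 h1 => ?_⟩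
  · rw [ha.finrank_Eig_eq hn hone, CayleyDickson.topDimMultiplicity_one]
  · rw [ha.finrank_Eig_eq hn ((hspec lam).1 hlam), CayleyDickson.topDimMultiplicity_of_ne h0 h1]
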